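/- A network is a finite directed acyclic graph with unit-capacity edges, in which the (non-empty) set of sources and the set of terminals are disjoint, no edge enters a source and no edge leaves a terminal; each source generates one message, and each terminal demands the messages of a set of sources. The network is multiple-unicast if each terminal demands exactly one message and each message is demanded by exactly one terminal. Let $F$ be a finite field and $k,n\ge 1$. In a $(k,n)$ fractional linear network code over $F$, every source $s$ generates a vector $X_s\in F^k$, and every edge $e$ carries a vector $Y_e\in F^n$, where $Y_e=A_{s,e}X_s$ with $A_{s,e}\in F^{n\times k}$ if $e$ leaves a source $s$, and $Y_e=\sum_{e'\in \mathrm{In}(v)}A_{e',e}Y_{e'}$ with $A_{e',e}\in F^{n\times n}$ if $e$ leaves a non-source node $v$; here $\mathrm{In}(v)$ is the set of edges ending at $v$. It is a $(k,n)$ fractional linear network coding solution if there are decoding matrices $B_{t,s,e}\in F^{k\times n}$ such that $X_s=\sum_{e\in \mathrm{In}(t)}B_{t,s,e}Y_e$ for every terminal $t$, every source $s$ whose message $t$ demands, and every choice of the messages. A network has a rate $k/n$ fractional linear network coding solution over $F$ if it has a $(dk,dn)$ fractional linear network coding solution over $F$ for some integer $d\ge 1$. **Theorem.** Let $k,n$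 be positive integers and let $S$ be a set of primes that is finite or co-finite (in the set of all primes). Then there is a multiple-unicast network $\mathcal N$ such that, for every finite field $F$, $\mathcal N$ has a rate $k/n$ fractional linear network coding solution over $F$ if and only if the characteristic of $F$ belongs to $S$. Moreover, $\mathcal N$ can be chosen so that, in addition, for every finite field $F$, $\mathcal N$ has a $(dk,dn)$ fractional linear network coding solution over $F$ for every integer $d\ge 1$ if and only if the characteristic of $F$ belongs to $S$. -/

import Mathlib

open scoped Matrix

/-- A network: a finite directed acyclic graph whose edges have unit capacity, with a
non-empty set of sources (no incoming edges, one message each) and a set of terminals (no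
outgoing edges), where each terminal demands the messages of a set of sources. -/
structure Network where
  /-- the nodes -/
  V : Type
  /-- the edges -/
  E : Type
  [fintypeV : Fintype V]
  [fintypeE : Fintype E]
  tail : E → V
  head : E → V
  /-- an edge is determined by its end points: `e` is the pair `(tail e, head e)` -/
  edge_ext : ∀ e e' : E, tail e = tail e' → head e = head e' → e = e'
  /-- there is no directed cycle -/
  acyclic : ∀ v : V, ¬ Relation.TransGen (fun u w => ∃ e : E, tail e = u ∧ head e = w) v v
  sources : Finset V
  terminals : Finset V
  sources_nonempty : sources.Nonempty
  disjoint_sources_terminals : Disjoint sources terminals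
  head_notMem_sources : ∀ e : E, head e ∉ sources
  tail_notMem_terminals : ∀ e : E, tail e ∉ terminals
  /-- the sources whose messages a terminal demands (only its values at terminals matter) -/
  demand : V → Finset V
  demand_subset : ∀ t ∈ terminals, demand t ⊆ sources

namespace Network

attribute [instance] Network.fintypeV Network.fintypeE

open Classical in
/-- The set of edges that end at the node `v`. -/
noncomputable def inEdges (N : Network) (v : N.V) : Finset N.E :=
  Finset.univ.filter (fun e => N.head e = v)

/-- Each terminal demands exactly one message, and each message is demanded by exactly
one terminal. -/
def IsMultipleUnicast (N : Network) : Prop :=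
  (∀ t ∈ N.terminals, ∃ s ∈ N.sources, N.demand t = {s}) ∧
    ∀ s ∈ N.sources, ∃! t, t ∈ N.terminals ∧ s ∈ N.demand t

/-- The local coding matrices of a `(k, n)` fractional linear network code over `F`.
Only the entries for edges `e` leaving a source, for consecutive edges `e'`, `e`, and for edges
entering a terminal that demands `s` are ever used. -/
structure FractionalCode (N : Network) (F : Type*) [Field F] (k n : ℕ) where
  /-- `ofSource e` multiplies the message of the source `tail e` -/
  ofSource : N.E → Matrix (Fin n) (Fin k) F
  /-- `ofEdge e' e` multiplies the information on `e'` as it is passed on to `e` -/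
  ofEdge : N.E → N.E → Matrix (Fin n) (Fin n) F
  /-- `decode t s e` multiplies the information on `e` when `t` computes the message of `s` -/
  decode : N.V → N.V → N.E → Matrix (Fin k) (Fin n) F

/-- `Y` is the information carried by the edges when the source `s` emits the message `X s`
(the values of `X` outside the sources play no role). -/
def FractionalCode.Carries {N : Network} {F : Type*} [Field F] {k n : ℕ}
    (C : N.FractionalCode F k n) (X : N.V → Fin k → F) (Y : N.E → Fin n → F) : Prop :=
  ∀ e : N.E,
    (N.tail e ∈ N.sources → Y e = C.ofSource e *ᵥ X (N.tail e)) ∧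
    (N.tail e ∉ N.sources → Y e = ∑ e' ∈ N.inEdges (N.tail e), C.ofEdge e' e *ᵥ Y e')

/-- The network has a `(k, n)` fractional linear network coding solution over `F`. -/
def HasFractionalSolution (N : Network) (F : Type*) [Field F] (k n : ℕ) : Prop :=
  ∃ C : N.FractionalCode F k n, ∀ X : N.V → Fin k → F, ∃ Y : N.E → Fin n → F,
    C.Carries X Y ∧
      ∀ t ∈ N.terminals, ∀ s ∈ N.demand t,
        X s = ∑ e ∈ N.inEdges t, C.decode t s e *ᵥ Y e

/-- The network has a rate `k / n` fractional linear network coding solution over `F`. -/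
def HasRateSolution (N : Network) (F : Type*) [Field F] (k n : ℕ) : Prop :=
  ∃ d : ℕ, 0 < d ∧ N.HasFractionalSolution F (d * k) (d * n)

end Network

/-! ### Linear maps with prescribed kernels -/

/-! Each message is split among `n` sources and each bottleneck into `k` paths, so in a `(dk, dn)`
code a message and a bottleneck both have dimension `dkn`. Recovering a message through one
bottleneck then forces invertible maps. The relay nodes realise parallel edges in a simple graph.

In `charShape q P`, the demands of the messages `some i` force, up to coordinate changes, `none` to
carry `∑ j, y j` and `some i` to vanish exactly when `∑ j, y j = y i`, as long as the message `none`
is zero (`exists_equiv_of_recover`). If all bottlenecks `some i` vanish, every `y i` equals the sum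
`v`, whence `q • v = 0`. The terminal of the message `none` tests this: with `P` it succeeds iff `q
≠ 0` in `F`, without `P` iff `q = 0`. Taking for `q` the product of the primes in `S`, or of those
outside `S`, gives the theorem. -/

/-- A section of `h` over its range defines `G` there, and `G` extends to all of `B` over a field.
-/
theorem LinearMap.exists_comp_eq_of_ker_le {F A B C : Type*} [Field F] [AddCommGroup A]
    [Module F A] [AddCommGroup B] [Module F B] [AddCommGroup C] [Module F C]
    (h : A →ₗ[F] B) (g : A →ₗ[F] C) (hle : ∀ x, h x = 0 → g x = 0) :
    ∃ G : B →ₗ[F] C, ∀ x, G (h x) = g x := by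
  obtain ⟨r, hr⟩ := h.rangeRestrict.exists_rightInverse_of_surjective h.range_rangeRestrict
  obtain ⟨G, hG⟩ := LinearMap.exists_extend (g ∘ₗ r)
  refine ⟨G, fun x => ?_⟩
  have h1 : G (h x) = g (r (h.rangeRestrict x)) := by
    have := LinearMap.congr_fun hG (h.rangeRestrict x)
    simpa using this
  have h2 : h (r (h.rangeRestrict x)) = h x := by
    have := LinearMap.congr_fun hr (h.rangeRestrict x)
    exact congrArg Subtype.val this
  rw [h1, ← sub_eq_zero, ← map_sub]
  exact hle _ (by rw [map_sub, h2, sub_self])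

open Classical in
theorem exists_matrix_sum_of_ker_le {F A ι : Type*} [Field F] [AddCommGroup A] [Module F A]
    [Fintype ι] {n p : ℕ} (s : Finset ι) (h : ι → A →ₗ[F] (Fin n → F))
    (g : A →ₗ[F] (Fin p → F)) (hle : ∀ x, (∀ i ∈ s, h i x = 0) → g x = 0) :
    ∃ M : ι → Matrix (Fin p) (Fin n) F, ∀ x, g x = ∑ i ∈ s, M i *ᵥ h i x := by
  obtain ⟨G, hG⟩ := LinearMap.exists_comp_eq_of_ker_le
    (LinearMap.pi fun i => if i ∈ s then h i else 0) g (fun x hx => hle x fun i hi => by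
      have := congrFun hx i
      simpa [hi] using this)
  refine ⟨fun i => LinearMap.toMatrix' (G ∘ₗ LinearMap.single F (fun _ : ι => Fin n → F) i), fun x => ?_⟩
  rw [← hG x, ← LinearMap.sum_single_apply (fun _ : ι => Fin n → F)
    ((LinearMap.pi fun i => if i ∈ s then h i else 0) x), map_sum,
    ← Finset.sum_subset (Finset.subset_univ s)]
  · refine Finset.sum_congr rfl fun i hi => ?_
    simp [LinearMap.toMatrix'_mulVec, hi]
  · intro i _ hi
    simp [hi]

/-! ### Coding solutions as kernel conditions -/

namespace Network

/-- A fractional solution amounts to a linear assignment of edge contents in which the content of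
each edge, and each demanded message, vanishes whenever the data it is computed from vanish. -/
theorem hasFractionalSolution_iff (N : Network) (F : Type*) [Field F] (k n : ℕ) :
    N.HasFractionalSolution F k n ↔
      ∃ Y : N.E → (N.V → Fin k → F) →ₗ[F] (Fin n → F),
        (∀ e X, N.tail e ∈ N.sources → X (N.tail e) = 0 → Y e X = 0) ∧
        (∀ e X, N.tail e ∉ N.sources → (∀ e', N.head e' = N.tail e → Y e' X = 0) → Y e X = 0) ∧
        ∀ t ∈ N.terminals, ∀ s ∈ N.demand t, ∀ X, (∀ e, N.head e = t → Y e X = 0) → X s = 0 := by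
  classical
  constructor
  · rintro ⟨C, hC⟩
    -- The code only yields some `Y` for each `X`. The consistent pairs form a subspace that
    -- projects onto all `X`, so a linear section makes the choice linear without induction along
    -- the graph.
    let R : Submodule F ((N.V → Fin k → F) × (N.E → Fin n → F)) :=
      { carrier := {p | C.Carries p.1 p.2 ∧ ∀ t ∈ N.terminals, ∀ s ∈ N.demand t,
          p.1 s = ∑ e ∈ N.inEdges t, C.decode t s e *ᵥ p.2 e}
        zero_mem' := by
          refine ⟨fun e => ⟨fun _ => ?_, fun _ => ?_⟩, fun t _ s _ => ?_⟩ <;> simp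
        add_mem' := by
          rintro p p' ⟨h1, h2⟩ ⟨h1', h2'⟩
          refine ⟨fun e => ⟨fun he => ?_, fun he => ?_⟩, fun t ht s hs => ?_⟩
          · simp [(h1 e).1 he, (h1' e).1 he, Matrix.mulVec_add]
          · simp [(h1 e).2 he, (h1' e).2 he, Matrix.mulVec_add, Finset.sum_add_distrib]
          · simp [h2 t ht s hs, h2' t ht s hs, Matrix.mulVec_add, Finset.sum_add_distrib]
        smul_mem' := by
          rintro a p ⟨h1, h2⟩
          refine ⟨fun e => ⟨fun he => ?_, fun he => ?_⟩, fun t ht s hs => ?_⟩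
          · simp [(h1 e).1 he, Matrix.mulVec_smul]
          · simp [(h1 e).2 he, Matrix.mulVec_smul, Finset.smul_sum]
          · simp [h2 t ht s hs, Matrix.mulVec_smul, Finset.smul_sum] }
    obtain ⟨r, hr⟩ := (LinearMap.fst F _ _ ∘ₗ R.subtype).exists_rightInverse_of_surjective (by
      rw [LinearMap.range_eq_top]
      intro X
      obtain ⟨Y, hY⟩ := hC X
      exact ⟨⟨(X, Y), hY⟩, rfl⟩)
    have hfst : ∀ X, (r X).1.1 = X := fun X => LinearMap.congr_fun hr X
    have hmem : ∀ X, C.Carries X (r X).1.2 ∧ ∀ t ∈ N.terminals, ∀ s ∈ N.demand t,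
        X s = ∑ e ∈ N.inEdges t, C.decode t s e *ᵥ (r X).1.2 e := by
      intro X
      have := (r X).2
      change C.Carries (r X).1.1 _ ∧ ∀ t ∈ N.terminals, ∀ s ∈ N.demand t, (r X).1.1 s = _ at this
      rwa [hfst] at this
    refine ⟨fun e => LinearMap.proj e ∘ₗ LinearMap.snd F _ _ ∘ₗ R.subtype ∘ₗ r, ?_, ?_, ?_⟩
    · intro e X he hX
      change (r X).1.2 e = 0
      rw [((hmem X).1 e).1 he, hX, Matrix.mulVec_zero]
    · intro e X he hX
      change (r X).1.2 e = 0
      rw [((hmem X).1 e).2 he]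
      refine Finset.sum_eq_zero fun e' he' => ?_
      have h0 : (r X).1.2 e' = 0 := hX e' (by simpa [inEdges] using he')
      rw [h0, Matrix.mulVec_zero]
    · intro t ht s hs X hX
      rw [(hmem X).2 t ht s hs]
      refine Finset.sum_eq_zero fun e he => ?_
      have h0 : (r X).1.2 e = 0 := hX e (by simpa [inEdges] using he)
      rw [h0, Matrix.mulVec_zero]
  · rintro ⟨Y, h1, h2, h3⟩
    have H1 : ∀ e, ∃ M : Matrix (Fin n) (Fin k) F, N.tail e ∈ N.sources →
        ∀ X, Y e X = M *ᵥ X (N.tail e) := by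
      intro e
      by_cases he : N.tail e ∈ N.sources
      · obtain ⟨G, hG⟩ := LinearMap.exists_comp_eq_of_ker_le
          (LinearMap.proj (R := F) (φ := fun _ : N.V => Fin k → F) (N.tail e)) (Y e)
          (fun X hX => h1 e X he hX)
        exact ⟨LinearMap.toMatrix' G, fun _ X => by
          rw [LinearMap.toMatrix'_mulVec]; exact (hG X).symm⟩
      · exact ⟨0, fun h => absurd h he⟩
    have H2 : ∀ e, ∃ M : N.E → Matrix (Fin n) (Fin n) F, N.tail e ∉ N.sources →
        ∀ X, Y e X = ∑ e' ∈ N.inEdges (N.tail e), M e' *ᵥ Y e' X := by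
      intro e
      by_cases he : N.tail e ∉ N.sources
      · obtain ⟨M, hM⟩ := exists_matrix_sum_of_ker_le (N.inEdges (N.tail e)) Y (Y e)
          (fun X hX => h2 e X he fun e' he' => hX e' (by simpa [inEdges] using he'))
        exact ⟨M, fun _ => hM⟩
      · exact ⟨0, fun h => absurd h he⟩
    have H3 : ∀ t s, ∃ M : N.E → Matrix (Fin k) (Fin n) F, t ∈ N.terminals → s ∈ N.demand t →
        ∀ X : N.V → Fin k → F, X s = ∑ e ∈ N.inEdges t, M e *ᵥ Y e X := by
      intro t s
      by_cases h : t ∈ N.terminals ∧ s ∈ N.demand t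
      · obtain ⟨M, hM⟩ := exists_matrix_sum_of_ker_le (N.inEdges t) Y
          (LinearMap.proj (R := F) (φ := fun _ : N.V => Fin k → F) s)
          (fun X hX => h3 t h.1 s h.2 X fun e he => hX e (by simpa [inEdges] using he))
        exact ⟨M, fun _ _ => hM⟩
      · exact ⟨0, fun ht hs => absurd ⟨ht, hs⟩ h⟩
    choose M1 hM1 using H1
    choose M2 hM2 using H2
    choose M3 hM3 using H3
    exact ⟨⟨M1, fun e' e => M2 e e', M3⟩, fun X => ⟨fun e => Y e X,
      fun e => ⟨fun he => hM1 e he X, fun he => hM2 e he X⟩,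
      fun t ht s hs => hM3 t s ht hs X⟩⟩

end Network

/-! ### Bottleneck networks -/

/-- The shape of a multiple-unicast network with messages `M` and bottlenecks `B`: which messages
enter a bottleneck, and which bottlenecks and messages the terminal demanding a message sees. -/
structure BottleneckShape (M B : Type) where
  enters : M → B → Prop
  sees : M → B → Prop
  side : M → M → Prop

namespace BottleneckShape

variable {M B : Type}

/-- The contents `f b` of the bottlenecks, as functions of the messages, allow every terminal to
recover the message it demands. -/
structure IsSolution {F W U : Type*} [Field F] [AddCommGroup W] [Module F W] [AddCommGroup U]
    [Module F U] (D : BottleneckShape M B) (f : B → (M → W) →ₗ[F] U) : Prop where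
  eq_zero : ∀ b x, (∀ s, D.enters s b → x s = 0) → f b x = 0
  decode : ∀ s x, (∀ b, D.sees s b → f b x = 0) → (∀ s', D.side s s' → x s' = 0) → x s = 0

/-- The nodes of the network in which every message is split among `n` sources, and every
bottleneck has `k` parallel paths. -/
inductive Node (M B : Type) (k n : ℕ) : Type
  | source (s : M) (i : Fin n)
  | sourceRelay (s : M) (i : Fin n) (j : Fin k)
  | merge (b : B)
  | relay (b : B) (j : Fin k)
  | terminal (s : M) (i : Fin n)

namespace Node

variable {k n : ℕ}

instance [Finite M] [Finite B] : Finite (Node M B k n) := by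
  let g : (M × Fin n) ⊕ (M × Fin n × Fin k) ⊕ B ⊕ (B × Fin k) ⊕ (M × Fin n) → Node M B k n
    | .inl (s, i) => source s i
    | .inr (.inl (s, i, j)) => sourceRelay s i j
    | .inr (.inr (.inl b)) => merge b
    | .inr (.inr (.inr (.inl (b, j)))) => relay b j
    | .inr (.inr (.inr (.inr (s, i)))) => terminal s i
  refine Finite.of_surjective g ?_
  rintro (⟨s, i⟩ | ⟨s, i, j⟩ | b | ⟨b, j⟩ | ⟨s, i⟩)
  · exact ⟨.inl (s, i), rfl⟩
  · exact ⟨.inr (.inl (s, i, j)), rfl⟩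
  · exact ⟨.inr (.inr (.inl b)), rfl⟩
  · exact ⟨.inr (.inr (.inr (.inl (b, j)))), rfl⟩
  · exact ⟨.inr (.inr (.inr (.inr (s, i)))), rfl⟩

/-- The layer of a node; edges go to higher layers. -/
def layer : Node M B k n → ℕ
  | source _ _ => 0
  | sourceRelay _ _ _ => 1
  | merge _ => 2
  | relay _ _ => 3
  | terminal _ _ => 4

/-- The source whose message a terminal demands. -/
def demand : Node M B k n → Finset (Node M B k n)
  | terminal s i => {source s i}
  | _ => ∅

end Node

open Node

/-- Adjacency of the nodes of the network of a shape. -/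
inductive Adj (D : BottleneckShape M B) (k n : ℕ) : Node M B k n → Node M B k n → Prop
  | source (s i j) : Adj D k n (source s i) (sourceRelay s i j)
  | enters (s i j b) : D.enters s b → Adj D k n (sourceRelay s i j) (merge b)
  | merge (b j) : Adj D k n (merge b) (relay b j)
  | sees (s i b j) : D.sees s b → Adj D k n (relay b j) (terminal s i)
  | side (s i s' i' j) : D.side s s' → Adj D k n (sourceRelay s' i' j) (terminal s i)

theorem Adj.layer_lt {D : BottleneckShape M B} {k n : ℕ} {u v : Node M B k n}
    (h : D.Adj k n u v) : u.layer < v.layer := by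
  cases h <;> simp [layer]

open Classical in
/-- The network of a shape, with `n` sources per message and `k` parallel paths per bottleneck. -/
noncomputable def network (D : BottleneckShape M B) [Finite M] [Finite B] [Nonempty M] (k n : ℕ)
    (hn : 0 < n) : Network :=
  letI : Fintype (Node M B k n) := Fintype.ofFinite _
  { V := Node M B k n
    E := {p : Node M B k n × Node M B k n // D.Adj k n p.1 p.2}
    fintypeV := Fintype.ofFinite _
    fintypeE := Fintype.ofFinite _
    tail := fun e => e.1.1
    head := fun e => e.1.2
    edge_ext := fun _ _ h h' => Subtype.ext (Prod.ext h h')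
    acyclic := by
      have key : ∀ u v : Node M B k n, Relation.TransGen (fun u w =>
          ∃ e : {p : Node M B k n × Node M B k n // D.Adj k n p.1 p.2}, e.1.1 = u ∧ e.1.2 = w)
          u v → u.layer < v.layer := by
        intro u v h
        induction h with
        | single h => obtain ⟨e, rfl, rfl⟩ := h; exact e.2.layer_lt
        | tail _ h ih => obtain ⟨e, rfl, rfl⟩ := h; exact ih.trans e.2.layer_lt
      exact fun v h => lt_irrefl _ (key v v h)
    sources := Finset.univ.filter fun v => ∃ s i, v = source s i
    terminals := Finset.univ.filter fun v => ∃ s i, v = terminal s i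
    sources_nonempty := ⟨source (Classical.arbitrary M) ⟨0, hn⟩, by simp⟩
    disjoint_sources_terminals := by
      rw [Finset.disjoint_filter]
      rintro _ _ ⟨s, i, rfl⟩ ⟨s', i', h⟩
      cases h
    head_notMem_sources := by
      rintro ⟨⟨u, v⟩, h⟩ hv
      obtain ⟨s, i, rfl⟩ := (Finset.mem_filter.1 hv).2
      cases h
    tail_notMem_terminals := by
      rintro ⟨⟨u, v⟩, h⟩ hv
      obtain ⟨s, i, rfl⟩ := (Finset.mem_filter.1 hv).2
      cases h
    demand := Node.demand
    demand_subset := by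
      intro t ht
      obtain ⟨s, i, rfl⟩ := (Finset.mem_filter.1 ht).2
      simp [Node.demand] }

/-! ### Solutions of the network and solutions of its shape -/

section

variable (D : BottleneckShape M B) [Finite M] [Finite B] [Nonempty M] {k n : ℕ} (hn : 0 < n)

/-- The edge of the network given by two adjacent nodes. -/
def edge {D : BottleneckShape M B} {u v : Node M B k n} (h : D.Adj k n u v) :
    (D.network k n hn).E := ⟨(u, v), h⟩

theorem mem_sources (v : Node M B k n) :
    v ∈ (D.network k n hn).sources ↔ ∃ s i, v = source s i := by
  classical
  let : Fintype (Node M B k n) := Fintype.ofFinite _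
  exact Finset.mem_filter_univ v

theorem mem_terminals (v : Node M B k n) :
    v ∈ (D.network k n hn).terminals ↔ ∃ s i, v = terminal s i := by
  classical
  let : Fintype (Node M B k n) := Fintype.ofFinite _
  exact Finset.mem_filter_univ v

theorem isMultipleUnicast_network : (D.network k n hn).IsMultipleUnicast := by
  constructor
  · intro t ht
    obtain ⟨s, i, rfl⟩ := (D.mem_terminals hn t).1 ht
    exact ⟨source s i, (D.mem_sources hn _).2 ⟨s, i, rfl⟩, rfl⟩
  · intro v hv
    obtain ⟨s, i, rfl⟩ := (D.mem_sources hn v).1 hv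
    refine ⟨terminal s i, ⟨(D.mem_terminals hn _).2 ⟨s, i, rfl⟩, Finset.mem_singleton_self _⟩, ?_⟩
    rintro t ⟨ht, hs⟩
    obtain ⟨s', i', rfl⟩ := (D.mem_terminals hn t).1 ht
    have := Finset.mem_singleton.1 hs
    cases this
    rfl

variable (F : Type*) [Field F] (a c : ℕ)

theorem exists_isSolution_of_hasFractionalSolution
    (h : (D.network k n hn).HasFractionalSolution F a c) :
    ∃ f : B → (M → Fin n → Fin a → F) →ₗ[F] (Fin k → Fin c → F), D.IsSolution f := by
  obtain ⟨Y, h1, h2, h3⟩ := (Network.hasFractionalSolution_iff _ F a c).1 h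
  let X : (M → Fin n → Fin a → F) →ₗ[F] (Node M B k n → Fin a → F) :=
    LinearMap.pi fun v => match v with
      | source s i => LinearMap.proj i ∘ₗ LinearMap.proj s
      | _ => 0
  have hX : ∀ x s i, X x (source s i) = x s i := fun _ _ _ => rfl
  have hrelay : ∀ x s, x s = 0 → ∀ i j, Y (edge hn (.source s i j)) (X x) = 0 := by
    intro x s hx i j
    refine h1 _ _ ((D.mem_sources hn _).2 ⟨s, i, rfl⟩) ?_
    change X x (source s i) = 0
    rw [hX, hx]
    rfl
  have hout : ∀ x s, x s = 0 → ∀ i j v (h : D.Adj k n (sourceRelay s i j) v),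
      Y (edge hn h) (X x) = 0 := by
    intro x s hx i j v h
    refine h2 _ _ (fun hm => ?_) ?_
    · obtain ⟨_, _, h'⟩ := (D.mem_sources hn _).1 hm
      cases h'
    · rintro ⟨⟨u, v'⟩, h'⟩ (rfl : v' = sourceRelay s i j)
      cases h'
      exact hrelay x s hx i j
  refine ⟨fun b => LinearMap.pi fun j => Y (edge hn (.merge b j)) ∘ₗ X, ?_, ?_⟩
  · intro b x hx
    funext j
    refine h2 _ _ (fun hm => ?_) ?_
    · obtain ⟨_, _, h'⟩ := (D.mem_sources hn _).1 hm
      cases h'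
    · rintro ⟨⟨u, v'⟩, h'⟩ (rfl : v' = merge b)
      cases h' with
      | enters s i j _ hs => exact hout x s (hx s hs) i j _ _
  · intro s x hb hs
    funext i
    rw [← hX x]
    refine h3 (terminal s i) ((D.mem_terminals hn _).2 ⟨s, i, rfl⟩) (source s i)
      (Finset.mem_singleton_self _) _ ?_
    rintro ⟨⟨u, v'⟩, h'⟩ (rfl : v' = terminal s i)
    cases h' with
    | side _ _ s' i' j h' => exact hout x s' (hs s' h') i' j _ _
    | sees _ _ b j h' =>
      refine h2 _ _ (fun hm => ?_) ?_
      · obtain ⟨_, _, h'⟩ := (D.mem_sources hn _).1 hm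
        cases h'
      · rintro ⟨⟨u, v'⟩, h''⟩ (rfl : v' = relay b j)
        cases h''
        exact congrFun (hb b h') j

/-- By `hac`, the `k` relays of a source together carry its message injectively, so the merge nodes
and side terminals can know it in full. -/
theorem hasFractionalSolution_of_isSolution (hac : a ≤ k * c)
    {f : B → (M → Fin n → Fin a → F) →ₗ[F] (Fin k → Fin c → F)} (hf : D.IsSolution f) :
    (D.network k n hn).HasFractionalSolution F a c := by
  obtain ⟨g, hg⟩ : ∃ g : (Fin a → F) →ₗ[F] (Fin k → Fin c → F), Function.Injective g := by
    rw [← finrank_le_iff_exists_linearMap]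
    simpa [Module.finrank_pi_fintype] using hac
  rw [Network.hasFractionalSolution_iff]
  let x : (Node M B k n → Fin a → F) →ₗ[F] (M → Fin n → Fin a → F) :=
    LinearMap.pi fun s => LinearMap.pi fun i => LinearMap.proj (source s i)
  let val : Node M B k n → (Node M B k n → Fin a → F) →ₗ[F] (Fin c → F)
    | sourceRelay s i j => LinearMap.proj j ∘ₗ g ∘ₗ LinearMap.proj (source s i)
    | relay b j => LinearMap.proj j ∘ₗ f b ∘ₗ x
    | _ => 0
  -- A relay has a single incoming edge, so all edges at a relay carry the content of that relay.
  let Y : Node M B k n × Node M B k n → (Node M B k n → Fin a → F) →ₗ[F] (Fin c → F)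
    | (sourceRelay s i j, _) => val (sourceRelay s i j)
    | (relay b j, _) => val (relay b j)
    | (_, v) => val v
  have hval : ∀ X s i, (∀ j, val (sourceRelay s i j) X = 0) → X (source s i) = 0 := by
    intro X s i h
    apply hg
    rw [map_zero]
    funext j
    exact h j
  refine ⟨fun e => Y e.1, ?_, ?_, ?_⟩
  · rintro ⟨⟨u, v⟩, h⟩ X hu hX
    obtain ⟨s, i, rfl⟩ := (D.mem_sources hn u).1 hu
    cases h with
    | source _ _ j =>
      change g (X (source s i)) j = 0
      have : X (source s i) = 0 := hX
      rw [this, map_zero]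
      rfl
  · rintro ⟨⟨u, v⟩, h⟩ X hu hX
    cases h with
    | source s i j => exact absurd ((D.mem_sources hn _).2 ⟨s, i, rfl⟩) hu
    | enters s i j b h => exact hX (edge hn (.source s i j)) rfl
    | side s i s' i' j h => exact hX (edge hn (.source s' i' j)) rfl
    | sees s i b j h => exact hX (edge hn (.merge b j)) rfl
    | merge b j =>
      change f b (x X) j = 0
      rw [hf.eq_zero b (x X)]
      · rfl
      · intro s hs
        funext i
        exact hval X s i fun j => hX (edge hn (.enters s i j b hs)) rfl
  · intro t ht v hv X hX
    obtain ⟨s, i, rfl⟩ := (D.mem_terminals hn t).1 ht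
    obtain rfl : v = source s i := Finset.mem_singleton.1 hv
    refine congrFun (hf.decode s (x X) ?_ ?_) i
    · intro b hb
      funext j
      exact hX (edge hn (.sees s i b j hb)) rfl
    · intro s' hs'
      funext i'
      exact hval X s' i' fun j => hX (edge hn (.side s i s' i' j hs')) rfl

end

/-! ### Shapes that detect the characteristic -/

/-- There are messages `some j`, `j ≤ q`, and `none`, a bottleneck `none` entered by all
`some j`, and bottlenecks `some i` entered by all `some j` with `j ≠ i`. The terminal
of `some i` sees these two and the message `none`, the terminal of `none` sees the bottlenecks
`some i`. If `P` holds, the message `none` enters the bottleneck `none`, which its terminal sees;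
otherwise it enters the bottleneck `some 0`. -/
def charShape (q : ℕ) (P : Prop) :
    BottleneckShape (Option (Fin (q + 1))) (Option (Fin (q + 1))) where
  enters
    | some _, none => True
    | some j, some i => j ≠ i
    | none, none => P
    | none, some i => i = 0 ∧ ¬ P
  sees
    | some _, none => True
    | some i, some i' => i' = i
    | none, none => P
    | none, some _ => True
  side
    | some _, none => True
    | _, _ => False

section

variable {F W U : Type*} [Field F] [AddCommGroup W] [Module F W] [AddCommGroup U] [Module F U]

/-- If each `x i` can be recovered from `c x` and `b i x`, where `b i` ignores `x i`, then up to
coordinate changes `c` is the sum of all coordinates and `b i` is the sum of those other than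
`i`. -/
theorem exists_equiv_of_recover [FiniteDimensional F W] [FiniteDimensional F U]
    (hdim : Module.finrank F W = Module.finrank F U) {ι : Type*} [Fintype ι] [DecidableEq ι]
    [Nontrivial ι] (c : (ι → W) →ₗ[F] U) (b : ι → (ι → W) →ₗ[F] U)
    (hb : ∀ i x, (∀ j, j ≠ i → x j = 0) → b i x = 0)
    (hdec : ∀ i x, c x = 0 → b i x = 0 → x i = 0) :
    ∃ φ : ι → W ≃ₗ[F] U, (∀ x, c x = ∑ j, φ j (x j)) ∧
      ∀ i x, b i x = 0 ↔ c x = φ i (x i) := by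
  have hbs : ∀ i v, b i (Pi.single i v) = 0 := fun i v =>
    hb i _ fun j hj => by simp [hj]
  have hinj : ∀ i, Function.Injective (c ∘ₗ LinearMap.single F (fun _ => W) i) := by
    intro i
    rw [← LinearMap.ker_eq_bot, LinearMap.ker_eq_bot']
    intro v hv
    simpa using hdec i (Pi.single i v) hv (hbs i v)
  let φ : ι → W ≃ₗ[F] U := fun i => LinearEquiv.ofInjectiveOfFinrankEq _ (hinj i) hdim
  have hφ : ∀ i v, φ i v = c (Pi.single i v) := fun i v => rfl
  -- Changing `x` at `i` does not affect `b i`, and can be used to make `c` vanish.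
  have fwd : ∀ i x, b i x = 0 → c x = φ i (x i) := by
    intro i x hx
    have := hdec i (x - Pi.single i ((φ i).symm (c x)))
      (by rw [map_sub, ← hφ]; simp) (by rw [map_sub, hx, hbs, sub_zero])
    rw [Pi.sub_apply, Pi.single_eq_same, sub_eq_zero] at this
    rw [this, LinearEquiv.apply_symm_apply]
  refine ⟨φ, fun x => ?_, fun i x => ⟨fwd i x, fun hx => ?_⟩⟩
  · conv_lhs => rw [← LinearMap.sum_single_apply (fun _ => W) x, map_sum]
    rfl
  -- A vector `v` at a second coordinate `j` reproduces `b i x`; applying `fwd` to the difference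
  -- shows `v = 0`.
  · obtain ⟨j, hj⟩ := exists_ne i
    have hsurj : Function.Surjective (b i ∘ₗ LinearMap.single F (fun _ => W) j) := by
      rw [← LinearMap.injective_iff_surjective_of_finrank_eq_finrank hdim,
        ← LinearMap.ker_eq_bot, LinearMap.ker_eq_bot']
      intro v hv
      have := fwd i (Pi.single j v) hv
      rw [← hφ, Pi.single_eq_of_ne hj.symm, map_zero] at this
      simpa using this
    obtain ⟨v, hv⟩ := hsurj (b i x)
    have hv' : b i (Pi.single j v) = b i x := hv
    have h := fwd i (x - Pi.single j v) (by rw [map_sub, hv', sub_self])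
    rw [map_sub, ← hφ, Pi.sub_apply, Pi.single_eq_of_ne hj.symm, sub_zero, hx,
      sub_eq_self] at h
    rw [← hv', (LinearEquiv.map_eq_zero_iff _).1 h, Pi.single_zero, map_zero]

/-- The linear map that extends a family of messages by a zero message `none`. -/
def extendSome (F W ι : Type*) [Field F] [AddCommGroup W] [Module F W] :
    (ι → W) →ₗ[F] (Option ι → W) :=
  LinearMap.pi fun
    | some i => LinearMap.proj i
    | none => 0

/-- Every bottleneck carries the plain sum of the messages that enter it. -/
theorem exists_isSolution_charShape (e : W ≃ₗ[F] U) (q : ℕ) (P : Prop)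
    (hq : P ↔ (q : F) ≠ 0) :
    ∃ f : Option (Fin (q + 1)) → (Option (Fin (q + 1)) → W) →ₗ[F] U,
      (charShape q P).IsSolution f := by
  classical
  let pr (s : Option (Fin (q + 1))) : (Option (Fin (q + 1)) → W) →ₗ[F] W := LinearMap.proj s
  let σ : (Option (Fin (q + 1)) → W) →ₗ[F] W := ∑ j, pr (some j)
  let h : Option (Fin (q + 1)) → (Option (Fin (q + 1)) → W) →ₗ[F] W
    | none => σ + if P then pr none else 0
    | some i => σ - pr (some i) + if i = 0 ∧ ¬ P then pr none else 0
  have hσ : ∀ x, σ x = ∑ j, x (some j) := fun x => by simp [σ, pr]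
  have hnone : ∀ x, h none x = σ x + if P then x none else 0 := fun x => by
    simp only [h, LinearMap.add_apply]; split_ifs <;> rfl
  have hsome : ∀ i x, h (some i) x = σ x - x (some i) + if i = 0 ∧ ¬ P then x none else 0 :=
    fun i x => by
      simp only [h, LinearMap.add_apply, LinearMap.sub_apply]; split_ifs <;> rfl
  refine ⟨fun b => e.toLinearMap ∘ₗ h b, ?_, ?_⟩
  · rintro (_ | i) x hx
    · have h1 : ∀ j, x (some j) = 0 := fun j => hx (some j) trivial
      have h2 : P → x none = 0 := fun hP => hx none hP
      change e (h none x) = 0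
      rw [hnone, hσ]
      simpa [h1] using h2
    · have h1 : ∀ j, j ≠ i → x (some j) = 0 := fun j hj => hx (some j) hj
      have h2 : i = 0 ∧ ¬ P → x none = 0 := fun hP => hx none hP
      change e (h (some i) x) = 0
      rw [hsome, hσ, Finset.sum_eq_single i (fun j _ hj => h1 j hj) (by simp), sub_self, zero_add]
      simpa using h2
  · rintro (_ | i) x hb hs
    · have h1 : ∀ i, h (some i) x = 0 := fun i =>
        (LinearEquiv.map_eq_zero_iff e).1 (hb (some i) trivial)
      by_cases hP : P
      · have h0 : h none x = 0 := (LinearEquiv.map_eq_zero_iff e).1 (hb none hP)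
        have h2 : ∀ i, x (some i) = σ x := fun i => by
          have := h1 i
          rw [hsome] at this
          exact (sub_eq_zero.1 (by simpa [hP] using this)).symm
        -- All `q + 1` summands equal the sum, so `q • σ x = 0`.
        have h3 : σ x = ((q : F) + 1) • σ x := by
          conv_lhs => rw [hσ]
          simp [h2, add_smul, Nat.cast_smul_eq_nsmul]
        rw [add_smul, one_smul, right_eq_add, smul_eq_zero] at h3
        rw [hnone, h3.resolve_left (hq.1 hP)] at h0
        simpa [hP] using h0
      · have hq0 : (q : F) = 0 := by simpa using mt hq.2 hP
        have h2 : ∀ i : Fin q, x (some i.succ) = σ x := fun i => by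
          have := h1 i.succ
          rw [hsome] at this
          exact (sub_eq_zero.1 (by simpa using this)).symm
        have h3 : σ x = x (some 0) := by
          conv_lhs => rw [hσ, Fin.sum_univ_succ]
          simp [h2, ← Nat.cast_smul_eq_nsmul F, hq0]
        have := h1 0
        rw [hsome, h3] at this
        simpa [hP] using this
    · have h0 : h none x = 0 := (LinearEquiv.map_eq_zero_iff e).1 (hb none trivial)
      have h1 : h (some i) x = 0 := (LinearEquiv.map_eq_zero_iff e).1 (hb (some i) rfl)
      have h2 : x none = 0 := hs none trivial
      rw [hnone, h2] at h0
      rw [hsome, h2] at h1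
      have h0' : σ x = 0 := by simpa using h0
      simpa [h0'] using h1

/-- In the wrong characteristic, some nonzero content of the bottleneck entered by the message
`none` can be cancelled by a nonzero value of that message, with every other bottleneck its terminal
sees zero; decoding then fails. -/
theorem iff_natCast_ne_zero_of_isSolution [FiniteDimensional F W] [FiniteDimensional F U]
    [Nontrivial U] (hdim : Module.finrank F W = Module.finrank F U) {q : ℕ} (hq : 0 < q) {P : Prop}
    {f : Option (Fin (q + 1)) → (Option (Fin (q + 1)) → W) →ₗ[F] U}
    (hf : (charShape q P).IsSolution f) : P ↔ (q : F) ≠ 0 := by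
  classical
  have : Nontrivial (Fin (q + 1)) := Fin.nontrivial_iff_two_le.2 (by omega)
  let E := extendSome F W (Fin (q + 1))
  let I := LinearMap.single F (fun _ : Option (Fin (q + 1)) => W) none
  have hI : ∀ w j, I w (some j) = 0 := fun w j => by simp [I]
  have hI' : ∀ w, I w none = w := fun w => by simp [I]
  obtain ⟨φ, hc, hb⟩ := exists_equiv_of_recover hdim (f none ∘ₗ E) (fun i => f (some i) ∘ₗ E)
    (by
      intro i x hx
      refine hf.eq_zero _ _ ?_
      rintro (_ | j) hs
      · rfl
      · exact hx j hs)
    (by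
      intro i x h0 h1
      refine hf.decode (some i) (E x) ?_ ?_
      · rintro (_ | j) hs
        · exact h0
        · obtain rfl : j = i := hs
          exact h1
      · rintro (_ | j) hs
        · rfl
        · exact hs.elim)
  -- the messages with prescribed images under the coordinate changes
  let x : (Fin (q + 1) → U) → Option (Fin (q + 1)) → W := fun y => E fun j => (φ j).symm (y j)
  have hcx : ∀ y, f none (x y) = ∑ j, y j := fun y => by
    have := hc fun j => (φ j).symm (y j)
    simpa using this
  have hbx : ∀ i y, f (some i) (x y) = 0 ↔ ∑ j, y j = y i := fun i y => by
    have := hb i fun j => (φ j).symm (y j)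
    rw [← hcx]
    simpa using this
  -- If `b` is the only seen bottleneck that the message `none` may enter, decoding makes its map
  -- into `b` injective, hence surjective by dimension.
  have surj : ∀ b, (∀ b', (charShape q P).sees none b' → b' ≠ b →
      ¬ (charShape q P).enters none b') → Function.Surjective (f b ∘ₗ I) := by
    intro b hbb
    rw [← LinearMap.injective_iff_surjective_of_finrank_eq_finrank hdim,
      ← LinearMap.ker_eq_bot, LinearMap.ker_eq_bot']
    intro w hw
    rw [← hI' w]
    refine hf.decode none (I w) ?_ ?_
    · intro b' hb'
      by_cases h : b' = b
      · rw [h]; exact hw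
      · refine hf.eq_zero _ _ ?_
        rintro (_ | j) hs
        · exact absurd hs (hbb b' hb' h)
        · exact hI w j
    · rintro (_ | j) hs <;> exact hs.elim
  obtain ⟨v, hv⟩ := exists_ne (0 : U)
  by_cases hP : P
  · refine iff_of_true hP fun hq0 => hv ?_
    obtain ⟨w, hw⟩ := surj none (by
      rintro (_ | i) _ h
      · exact absurd rfl h
      · exact fun h => h.2 hP) v
    have hsum : ∑ _j : Fin (q + 1), v = v := by
      simp [← Nat.cast_smul_eq_nsmul F, hq0]
    have h0 : (x (fun _ => v) - I w) none = 0 := by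
      refine hf.decode none _ ?_ ?_
      · rintro (_ | i) _
        · rw [map_sub, hcx, hsum, sub_eq_zero]
          exact hw.symm
        · rw [map_sub, (hbx i _).2 hsum, zero_sub, neg_eq_zero]
          refine hf.eq_zero _ _ ?_
          rintro (_ | j) hs
          · exact absurd hP hs.2
          · exact hI w j
      · rintro (_ | j) hs <;> exact hs.elim
    rw [Pi.sub_apply, hI'] at h0
    have hw0 : w = 0 := by
      have : x (fun _ => v) none = 0 := rfl
      simpa [this] using h0
    rw [← hw, hw0, map_zero]
  · refine iff_of_false hP fun hq0 => ?_
    -- `y j` equals the sum of all coordinates for `j ≠ 0`, but not for `j = 0`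
    let y : Fin (q + 1) → U := Fin.cons (v - (q : F) • v) fun _ => v
    have hsum : ∑ j, y j = v := by
      rw [Fin.sum_univ_succ]
      simp [y, ← Nat.cast_smul_eq_nsmul F]
    obtain ⟨w, hw⟩ := surj (some 0) (by
      rintro (_ | i) h h'
      · exact absurd h hP
      · exact fun h => h' (by rw [h.1])) (f (some 0) (x y))
    have h0 : (x y - I w) none = 0 := by
      refine hf.decode none _ ?_ ?_
      · rintro (_ | i) hs
        · exact absurd hs hP
        · rcases Fin.eq_zero_or_eq_succ i with rfl | ⟨i, rfl⟩
          · rw [map_sub, sub_eq_zero]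
            exact hw.symm
          · rw [map_sub, (hbx _ y).2 (by rw [hsum]; simp [y]), zero_sub, neg_eq_zero]
            refine hf.eq_zero _ _ ?_
            rintro (_ | j) hs
            · exact absurd hs.1 (Fin.succ_ne_zero i)
            · exact hI w j
      · rintro (_ | j) hs <;> exact hs.elim
    rw [Pi.sub_apply, hI'] at h0
    have hw0 : w = 0 := by
      have : x y none = 0 := rfl
      simpa [this] using h0
    rw [hw0, map_zero] at hw
    have h1 := (hbx 0 y).1 hw.symm
    rw [hsum] at h1
    have h2 : (q : F) • v = 0 := sub_eq_self.1 h1.symm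
    exact (smul_ne_zero hq0 hv) h2

end

/-- The criterion does not depend on `d`, which is why a single network serves both the rate
statement and the one for all `d`. -/
theorem hasFractionalSolution_charShape_iff {k n q d : ℕ} (hk : 0 < k) (hn : 0 < n) (hq : 0 < q)
    (hd : 0 < d) (P : Prop) (F : Type*) [Field F] :
    ((charShape q P).network k n hn).HasFractionalSolution F (d * k) (d * n) ↔
      (P ↔ (q : F) ≠ 0) := by
  have hdim : Module.finrank F (Fin n → Fin (d * k) → F) =
      Module.finrank F (Fin k → Fin (d * n) → F) := by
    simp [Module.finrank_pi_fintype]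
    ring
  have : Nonempty (Fin k) := ⟨⟨0, hk⟩⟩
  have : Nonempty (Fin (d * n)) := ⟨⟨0, Nat.mul_pos hd hn⟩⟩
  constructor
  · intro h
    obtain ⟨f, hf⟩ := exists_isSolution_of_hasFractionalSolution _ hn F _ _ h
    exact iff_natCast_ne_zero_of_isSolution hdim hq hf
  · intro h
    obtain ⟨f, hf⟩ := exists_isSolution_charShape (LinearEquiv.ofFinrankEq _ _ hdim) q P h
    refine hasFractionalSolution_of_isSolution _ hn F _ _ ?_ hf
    calc d * k = k * d := Nat.mul_comm _ _
      _ ≤ k * (d * n) := Nat.mul_le_mul_left k (Nat.le_mul_of_pos_right d hn)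

end BottleneckShape

/-! ### Choice of `q` and conclusion -/

/-- A finite set of primes is the set of prime divisors of some `q > 0`. -/
theorem exists_prime_dvd_iff_mem (T : Set ℕ) (hT : T.Finite) (hp : ∀ p ∈ T, p.Prime) :
    ∃ q : ℕ, 0 < q ∧ ∀ p : ℕ, p.Prime → (p ∣ q ↔ p ∈ T) := by
  refine ⟨∏ p ∈ hT.toFinset, p, Finset.prod_pos fun p h => (hp p (by simpa using h)).pos, ?_⟩
  intro p hprime
  rw [hprime.prime.dvd_finsetProd_iff]
  constructor
  · rintro ⟨p', hT', hdvd⟩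
    rw [Set.Finite.mem_toFinset] at hT'
    rwa [(Nat.prime_dvd_prime_iff_eq hprime (hp p' hT')).1 hdvd]
  · exact fun h => ⟨_, by simpa using h, dvd_rfl⟩

theorem mainTheorem1 (k n : ℕ) (hk : 0 < k) (hn : 0 < n) (S : Set ℕ)
    (hS : ∀ p ∈ S, p.Prime) (hfin : S.Finite ∨ ({p : ℕ | p.Prime} \ S).Finite) :
    ∃ N : Network, N.IsMultipleUnicast ∧
      ∀ (F : Type*) [Field F] [Finite F],
        (N.HasRateSolution F k n ↔ ringChar F ∈ S) ∧
        ((∀ d : ℕ, 0 < d → N.HasFractionalSolution F (d * k) (d * n)) ↔ ringChar F ∈ S) := by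
  -- `P` is false for finite `S`, with `q` built from `S`, and true for co-finite `S`, with `q`
  -- built from its complement.
  obtain ⟨q, hq, P, hP⟩ : ∃ q : ℕ, 0 < q ∧ ∃ P : Prop, ∀ p : ℕ, p.Prime →
      ((P ↔ ¬ p ∣ q) ↔ p ∈ S) := by
    rcases hfin with h | h
    · obtain ⟨q, hq, hF⟩ := exists_prime_dvd_iff_mem S h hS
      exact ⟨q, hq, False, fun p hp => by simpa using hF p hp⟩
    · obtain ⟨q, hq, hF⟩ := exists_prime_dvd_iff_mem _ h fun p hp => hp.1
      exact ⟨q, hq, True, fun p hp => by simp [hF p hp, hp]⟩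
  refine ⟨(BottleneckShape.charShape q P).network k n hn,
    BottleneckShape.isMultipleUnicast_network _ hn, fun F _ _ => ?_⟩
  have key : ∀ d : ℕ, 0 < d →
      (((BottleneckShape.charShape q P).network k n hn).HasFractionalSolution F (d * k) (d * n) ↔ ringChar F ∈ S) := fun d hd =>
    (BottleneckShape.hasFractionalSolution_charShape_iff hk hn hq hd P F).trans (by
      rw [← hP _ (CharP.char_is_prime F _), Ne, ringChar.spec])
  exact ⟨⟨fun ⟨d, hd, h⟩ => (key d hd).1 h, fun h => ⟨1, one_pos, (key 1 one_pos).2 h⟩⟩,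
    fun h => (key 1 one_pos).1 (h 1 one_pos), fun h d hd => (key d hd).2 h⟩
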